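/- A drawing of a finite graph in the plane represents the vertices by distinct points and each edge by a Jordan arc (a simple curve) joining its endpoints and passing through no other vertex. Two edges cross if they have a common point that is not a vertex. A drawing is quasiplanar if it contains no three pairwise crossing edges. A drawing is in general position if any two of its edges have only finitely many points in common and each of these points is either a vertex or a proper crossing (locally, up to a homeomorphism of a neighbourhood, the two edges are the two coordinate axes). A matching is a graph in which no two edges share an endpoint. A QuaSEFE of two graphs $\langle G_1,G_2\rangle$ on a common vertex set $V$ is a pair of quasiplanar drawings $\Gamma_1$ of $G_1$ and $\Gamma_2$ of $G_2$ such that every vertex of $V$ has the same position in both and every edge shared by $G_1$ and $G_2$ is drawn as the same curve in both. **Theorem.** There are two matchings $M_1=(V,E_1)$ and $M_2=(V,E_2)$ on the same finite vertex set $V$ and a quasiplanar drawing $\Gamma_1$ of $M_1$ in general position such that $\langle M_1,M_2\rangle$ admits no QuaSEFE in which the drawing of $M_1$ is $\Gamma_1$ (whether or not the drawing of $M_2$ is required to be in general position). -/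

import Mathlib

namespace QuaSEFE

/-- The plane. Only its topology is used. -/
abbrev Plane : Type := ℝ × ℝ

/-- A graph is a matching if no two distinct edges share an endpoint. -/
def IsMatching {V : Type*} (G : SimpleGraph V) : Prop :=
  ∀ u v w : V, G.Adj u v → G.Adj u w → v = w

/-- A (topological) drawing of a graph in the plane: vertices are distinct points, every edge is a
Jordan arc (the image of an injective path) joining its two endpoints, and no edge passes through
a vertex other than its endpoints. -/
structure Drawing {V : Type*} (G : SimpleGraph V) where
  /-- the positions of the vertices -/
  pos : V → Plane
  pos_injective : Function.Injective pos
  /-- the point set that represents an edge -/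
  arc : G.edgeSet → Set Plane
  isArc : ∀ (u v : V) (h : G.Adj u v), ∃ γ : Path (pos u) (pos v),
    Function.Injective γ ∧ Set.range γ = arc ⟨s(u, v), (G.mem_edgeSet).2 h⟩
  mem_of_pos_mem_arc : ∀ (e : G.edgeSet) (v : V), pos v ∈ arc e → v ∈ (e : Sym2 V)

/-- The point sets `A` and `B` cross properly at `p`: in a suitable local chart of the plane
around `p` they are the two coordinate axes. -/
def CrossProperlyAt (A B : Set Plane) (p : Plane) : Prop :=
  ∃ φ : OpenPartialHomeomorph Plane Plane, p ∈ φ.source ∧ φ p = (0, 0) ∧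
    ∀ q ∈ φ.source, (q ∈ A ↔ (φ q).2 = 0) ∧ (q ∈ B ↔ (φ q).1 = 0)

namespace Drawing

variable {V : Type*} {G : SimpleGraph V}

/-- Two distinct edges cross if they have a common point that is not a vertex; such a point is
interior to both arcs. -/
def Crosses (Γ : Drawing G) (e f : G.edgeSet) : Prop :=
  e ≠ f ∧ ∃ p, p ∈ Γ.arc e ∧ p ∈ Γ.arc f ∧ p ∉ Set.range Γ.pos

/-- A drawing is quasiplanar if no three edges pairwise cross. -/
def IsQuasiplanar (Γ : Drawing G) : Prop :=
  ¬ ∃ e f g : G.edgeSet, Γ.Crosses e f ∧ Γ.Crosses f g ∧ Γ.Crosses e g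

/-- Any two edges have finitely many points in common, and each of them is a vertex or a proper
crossing (the edges do not merely touch there). -/
def IsInGeneralPosition (Γ : Drawing G) : Prop :=
  ∀ e f : G.edgeSet, e ≠ f → (Γ.arc e ∩ Γ.arc f).Finite ∧
    ∀ p ∈ Γ.arc e ∩ Γ.arc f, p ∉ Set.range Γ.pos → CrossProperlyAt (Γ.arc e) (Γ.arc f) p

end Drawing

/-- The drawings `Γ₁` of `G₁` and `Γ₂` of `G₂` form a QuaSEFE of `⟨G₁, G₂⟩`: both are quasiplanar,
every vertex has the same position in both, and every shared edge is drawn in the same way. -/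
def IsQuaSEFE {V : Type*} {G₁ G₂ : SimpleGraph V} (Γ₁ : Drawing G₁) (Γ₂ : Drawing G₂) : Prop :=
  Γ₁.IsQuasiplanar ∧ Γ₂.IsQuasiplanar ∧ (∀ v : V, Γ₁.pos v = Γ₂.pos v) ∧
    ∀ (e : Sym2 V) (h₁ : e ∈ G₁.edgeSet) (h₂ : e ∈ G₂.edgeSet), Γ₁.arc ⟨e, h₁⟩ = Γ₂.arc ⟨e, h₂⟩

end QuaSEFE

/-! The first matching is drawn as five arcs whose crossing graph is a five-cycle. This graph has no
triangle, so the drawing is quasiplanar. Any two consecutive arcs together contain the boundary of a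
rectangle that has the origin inside and (0, 10) outside. The second matching adds one edge between
these two points, and that edge, being connected, must meet at least one arc of every consecutive
pair (`inter_fiveArc_nonempty_or`). The arcs it meets thus form a vertex cover of an odd cycle, and
such a cover contains two consecutive arcs (`exists_and_succ_of_forall_or_succ`). With the new edge,
these are three pairwise crossing edges. -/

namespace QuaSEFE

open Set

/-! ### Jordan arcs -/

/-- `S` is a Jordan arc from `p` to `q`. -/
def IsJordanArc (S : Set Plane) (p q : Plane) : Prop :=
  ∃ γ : Path p q, Function.Injective γ ∧ range γ = S

theorem IsJordanArc.symm {S : Set Plane} {p q : Plane} (h : IsJordanArc S p q) :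
    IsJordanArc S q p := by
  obtain ⟨γ, hγ, rfl⟩ := h
  refine ⟨γ.symm, ?_, γ.symm_range⟩
  intro s t hst
  exact unitInterval.symm_bijective.injective (hγ hst)

theorem IsJordanArc.union {S T : Set Plane} {p q r : Plane} (hS : IsJordanArc S p q)
    (hT : IsJordanArc T q r) (hST : ∀ z ∈ S, z ∈ T → z = q) : IsJordanArc (S ∪ T) p r := by
  obtain ⟨γ, hγ, rfl⟩ := hS
  obtain ⟨δ, hδ, rfl⟩ := hT
  refine ⟨γ.trans δ, ?_, Path.trans_range γ δ⟩
  -- A value taken on both halves lies in `S` and in `T`, hence equals `q`; injectivity of `δ` then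
  -- puts the second parameter at 1/2.
  have mixed : ∀ (s t : unitInterval) (hs : (s : ℝ) ≤ 1 / 2) (ht : ¬ (t : ℝ) ≤ 1 / 2),
      γ.trans δ s ≠ γ.trans δ t := by
    intro s t hs ht h
    rw [Path.trans_apply, Path.trans_apply, dif_pos hs, dif_neg ht] at h
    have hq := hST _ ⟨_, h⟩ (mem_range_self _)
    have := congrArg Subtype.val (hδ (hq.trans δ.source.symm))
    simp only [Set.Icc.coe_zero] at this
    linarith
  intro s t h
  by_cases hs : (s : ℝ) ≤ 1 / 2 <;> by_cases ht : (t : ℝ) ≤ 1 / 2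
  · rw [Path.trans_apply, Path.trans_apply, dif_pos hs, dif_pos ht] at h
    have := congrArg Subtype.val (hγ h)
    simp only at this
    exact Subtype.ext (by linarith)
  · exact absurd h (mixed s t hs ht)
  · exact absurd h.symm (mixed t s ht hs)
  · rw [Path.trans_apply, Path.trans_apply, dif_neg hs, dif_neg ht] at h
    have := congrArg Subtype.val (hδ h)
    simp only at this
    exact Subtype.ext (by linarith)

theorem isJordanArc_horizontal {a b c : ℝ} (hab : a < b) :
    IsJordanArc (Icc (a, c) (b, c)) (a, c) (b, c) := by
  refine ⟨⟨⟨fun t => (a + t * (b - a), c), by fun_prop⟩, by simp, by simp⟩, ?_, ?_⟩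
  · intro s t h
    have h1 := congrArg Prod.fst h
    simp only [Path.coe_mk_mk] at h1
    exact Subtype.ext (mul_right_cancel₀ (sub_ne_zero.2 hab.ne') (by linarith))
  · ext ⟨x, y⟩
    simp only [Path.coe_mk_mk, mem_range, Prod.mk.injEq, mem_Icc, Prod.mk_le_mk]
    constructor
    · rintro ⟨⟨t, h0, h1⟩, rfl, rfl⟩
      simp only [le_refl, and_true]
      constructor <;> nlinarith
    · rintro ⟨⟨h1, h2⟩, h3, h4⟩
      have hd : 0 < b - a := sub_pos.2 hab
      refine ⟨⟨(x - a) / (b - a), div_nonneg (by linarith) hd.le,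
        (div_le_one hd).2 (by linarith)⟩, ?_, le_antisymm h2 h4⟩
      simp only
      field_simp
      ring

theorem IsJordanArc.swap {S : Set Plane} {p q : Plane} (h : IsJordanArc S p q) :
    IsJordanArc (Prod.swap '' S) p.swap q.swap := by
  obtain ⟨γ, hγ, rfl⟩ := h
  refine ⟨γ.map continuous_swap, Prod.swap_injective.comp hγ, ?_⟩
  rw [← range_comp]
  rfl

theorem isJordanArc_vertical {a b c : ℝ} (hab : a < b) :
    IsJordanArc (Icc (c, a) (c, b)) (c, a) (c, b) := by
  have h := (isJordanArc_horizontal (c := c) hab).swap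
  rw [image_swap_eq_preimage_swap] at h
  have hS : (Prod.swap ⁻¹' Icc (a, c) (b, c) : Set Plane) = Icc (c, a) (c, b) := by
    ext ⟨x, y⟩
    simp [and_comm]
  rwa [hS] at h

theorem mem_horizontal_iff {a b c x y : ℝ} :
    (x, y) ∈ Icc (a, c) (b, c) ↔ a ≤ x ∧ x ≤ b ∧ y = c := by
  rw [mem_Icc, Prod.mk_le_mk, Prod.mk_le_mk, le_antisymm_iff]
  tauto

theorem mem_vertical_iff {a b c x y : ℝ} :
    (x, y) ∈ Icc (c, a) (c, b) ↔ x = c ∧ a ≤ y ∧ y ≤ b := by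
  rw [mem_Icc, Prod.mk_le_mk, Prod.mk_le_mk, le_antisymm_iff]
  tauto

/-! ### Proper crossings -/

theorem CrossProperlyAt.symm {A B : Set Plane} {p : Plane} (h : CrossProperlyAt A B p) :
    CrossProperlyAt B A p := by
  obtain ⟨φ, hp, h0, hφ⟩ := h
  refine ⟨φ.trans (Homeomorph.prodComm ℝ ℝ).toOpenPartialHomeomorph, by simpa using hp,
    by simp [h0], fun q hq => ?_⟩
  have hq' : q ∈ φ.source := by simpa using hq
  simpa using (hφ q hq').symm

/-- The chart is the translation taking (a, b) to the origin, restricted to an open square. `A` is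
the horizontal set and `B` the vertical one. -/
theorem crossProperlyAt_of_square {A B : Set Plane} {a b r : ℝ} (hr : 0 < r)
    (h : ∀ x y : ℝ, a - r < x → x < a + r → b - r < y → y < b + r →
      ((x, y) ∈ A ↔ y = b) ∧ ((x, y) ∈ B ↔ x = a)) : CrossProperlyAt A B (a, b) := by
  refine ⟨(Homeomorph.subRight ((a, b) : Plane)).toOpenPartialHomeomorph.restrOpen
    (Ioo (a - r) (a + r) ×ˢ Ioo (b - r) (b + r)) (isOpen_Ioo.prod isOpen_Ioo), ?_, ?_, ?_⟩
  · simp [hr]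
  · exact Prod.ext (sub_self a) (sub_self b)
  · rintro ⟨x, y⟩ hq
    simp only [OpenPartialHomeomorph.restrOpen_source, Homeomorph.toOpenPartialHomeomorph_source,
      univ_inter, mem_prod, mem_Ioo] at hq
    simpa [sub_eq_zero] using h x y hq.1.1 hq.1.2 hq.2.1 hq.2.2

/-! ### Separation by a rectangle -/

/-- The closed rectangle and the complement of the open one are closed and cover the plane; a
preconnected set meeting both meets their intersection, which lies in the four sides. This
elementary fact replaces the Jordan curve theorem. -/
theorem exists_mem_boundary_of_isPreconnected {S : Set Plane} (hS : IsPreconnected S)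
    {a b c d : ℝ} {p q : Plane} (hpS : p ∈ S) (hqS : q ∈ S)
    (hp : p ∈ Icc a b ×ˢ Icc c d) (hq : q ∉ Ioo a b ×ˢ Ioo c d) :
    ∃ z ∈ S, z ∈ Icc (a, c) (a, d) ∪ Icc (b, c) (b, d) ∪ Icc (a, c) (b, c) ∪ Icc (a, d) (b, d) := by
  have hcl : IsClosed (Icc a b ×ˢ Icc c d) := isClosed_Icc.prod isClosed_Icc
  have hop : IsOpen (Ioo a b ×ˢ Ioo c d) := isOpen_Ioo.prod isOpen_Ioo
  obtain ⟨⟨x, y⟩, hz, ⟨⟨h1, h2⟩, h3, h4⟩, hzo⟩ := isPreconnected_closed_iff.1 hS _ _ hcl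
    hop.isClosed_compl
    (fun z _ => by
      by_cases h : z ∈ Ioo a b ×ˢ Ioo c d
      · exact Or.inl ⟨Ioo_subset_Icc_self h.1, Ioo_subset_Icc_self h.2⟩
      · exact Or.inr h) ⟨p, hpS, hp⟩ ⟨q, hqS, hq⟩
  refine ⟨(x, y), hz, ?_⟩
  simp only at h1 h2 h3 h4
  simp only [mem_compl_iff, mem_prod, mem_Ioo, not_and_or, not_lt] at hzo
  simp only [mem_union, mem_Icc, Prod.mk_le_mk]
  rcases hzo with (h | h) | (h | h)
  · exact Or.inl (Or.inl (Or.inl ⟨⟨h1, h3⟩, h, h4⟩))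
  · exact Or.inl (Or.inl (Or.inr ⟨⟨h, h3⟩, h2, h4⟩))
  · exact Or.inl (Or.inr ⟨⟨h1, h3⟩, h2, h⟩)
  · exact Or.inr ⟨⟨h1, h⟩, h2, h4⟩

/-! ### Five arcs whose crossing graph is a five-cycle

Any two consecutive arcs together contain the boundary of a rectangle around the origin. -/

/-- The five arcs. -/
def fiveArc : Fin 5 → Set Plane := ![
  Icc (-5, 1) (5, 1),
  Icc (-4, -2) (-4, 5) ∪ (Icc (-4, -2) (4, -2) ∪ Icc (4, -2) (4, 5)),
  Icc (-7, 4) (7, 4),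
  Icc (-3, 2) (3, 2) ∪ (Icc (-3, 2) (-3, 6) ∪ (Icc (-6, 6) (-3, 6) ∪ (Icc (-6, -3) (-6, 6) ∪
    (Icc (-6, -3) (6, -3) ∪ Icc (6, -3) (6, 5))))),
  Icc (-2, -1) (-2, 3) ∪ (Icc (-2, -1) (2, -1) ∪ Icc (2, -1) (2, 3))]

theorem mem_fiveArc_zero {x y : ℝ} : (x, y) ∈ fiveArc 0 ↔ -5 ≤ x ∧ x ≤ 5 ∧ y = 1 := by
  simp only [fiveArc, Matrix.cons_val, mem_horizontal_iff]

theorem mem_fiveArc_one {x y : ℝ} : (x, y) ∈ fiveArc 1 ↔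
    x = -4 ∧ -2 ≤ y ∧ y ≤ 5 ∨ -4 ≤ x ∧ x ≤ 4 ∧ y = -2 ∨ x = 4 ∧ -2 ≤ y ∧ y ≤ 5 := by
  simp only [fiveArc, Matrix.cons_val, mem_union, mem_horizontal_iff, mem_vertical_iff]

theorem mem_fiveArc_two {x y : ℝ} : (x, y) ∈ fiveArc 2 ↔ -7 ≤ x ∧ x ≤ 7 ∧ y = 4 := by
  simp only [fiveArc, Matrix.cons_val, mem_horizontal_iff]

theorem mem_fiveArc_three {x y : ℝ} : (x, y) ∈ fiveArc 3 ↔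
    -3 ≤ x ∧ x ≤ 3 ∧ y = 2 ∨ x = -3 ∧ 2 ≤ y ∧ y ≤ 6 ∨ -6 ≤ x ∧ x ≤ -3 ∧ y = 6 ∨
      x = -6 ∧ -3 ≤ y ∧ y ≤ 6 ∨ -6 ≤ x ∧ x ≤ 6 ∧ y = -3 ∨ x = 6 ∧ -3 ≤ y ∧ y ≤ 5 := by
  simp only [fiveArc, Matrix.cons_val, mem_union, mem_horizontal_iff, mem_vertical_iff]

theorem mem_fiveArc_four {x y : ℝ} : (x, y) ∈ fiveArc 4 ↔
    x = -2 ∧ -1 ≤ y ∧ y ≤ 3 ∨ -2 ≤ x ∧ x ≤ 2 ∧ y = -1 ∨ x = 2 ∧ -1 ≤ y ∧ y ≤ 3 := by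
  simp only [fiveArc, Matrix.cons_val, mem_union, mem_horizontal_iff, mem_vertical_iff]

/-- The first ten points are the endpoints of the five arcs; the rectangles formed by the arcs
separate the last two. -/
def vertexPos : Fin 12 → Plane := ![(-5, 1), (5, 1), (-4, 5), (4, 5), (-7, 4), (7, 4), (3, 2), (6, 5),
  (-2, 3), (2, 3), (0, 0), (0, 10)]

/-- The `k`-th pair of consecutive vertices. -/
def pairEdge (k : Fin 6) : Sym2 (Fin 12) :=
  s(⟨2 * k, by omega⟩, ⟨2 * k + 1, by omega⟩)

theorem isJordanArc_fiveArc (k : Fin 5) :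
    IsJordanArc (fiveArc k) (vertexPos ⟨2 * k, by omega⟩) (vertexPos ⟨2 * k + 1, by omega⟩) := by
  fin_cases k
  · exact isJordanArc_horizontal (by norm_num)
  · refine (isJordanArc_vertical (by norm_num)).symm.union
      ((isJordanArc_horizontal (by norm_num)).union (isJordanArc_vertical (by norm_num)) ?_) ?_ <;>
    · rintro ⟨x, y⟩
      simp only [mem_union, mem_horizontal_iff, mem_vertical_iff, Prod.mk.injEq]
      grind
  · exact isJordanArc_horizontal (by norm_num)
  · refine (isJordanArc_horizontal (by norm_num)).symm.union
      ((isJordanArc_vertical (by norm_num)).union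
      ((isJordanArc_horizontal (by norm_num)).symm.union
      ((isJordanArc_vertical (by norm_num)).symm.union
      ((isJordanArc_horizontal (by norm_num)).union
      (isJordanArc_vertical (by norm_num)) ?_) ?_) ?_) ?_) ?_ <;>
    · rintro ⟨x, y⟩
      simp only [mem_union, mem_horizontal_iff, mem_vertical_iff, Prod.mk.injEq]
      grind
  · refine (isJordanArc_vertical (by norm_num)).symm.union
      ((isJordanArc_horizontal (by norm_num)).union (isJordanArc_vertical (by norm_num)) ?_) ?_ <;>
    · rintro ⟨x, y⟩
      simp only [mem_union, mem_horizontal_iff, mem_vertical_iff, Prod.mk.injEq]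
      grind

theorem vertexPos_injective : Function.Injective vertexPos := by
  intro u v
  fin_cases u <;> fin_cases v <;> norm_num [vertexPos]

theorem mem_pairEdge_of_vertexPos_mem (k : Fin 5) (v : Fin 12) (h : vertexPos v ∈ fiveArc k) :
    v ∈ pairEdge k.castSucc := by
  revert h
  fin_cases k <;> fin_cases v <;>
    simp [vertexPos, mem_fiveArc_zero, mem_fiveArc_one, mem_fiveArc_two, mem_fiveArc_three,
      mem_fiveArc_four, pairEdge] <;> norm_num

/-- Two sets meet in finitely many points, all of them proper crossings. -/
def MeetProperly (A B : Set Plane) : Prop :=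
  (A ∩ B).Finite ∧ ∀ p ∈ A ∩ B, CrossProperlyAt A B p

theorem MeetProperly.symm {A B : Set Plane} (h : MeetProperly A B) : MeetProperly B A :=
  ⟨inter_comm A B ▸ h.1, fun p hp => (h.2 p ⟨hp.2, hp.1⟩).symm⟩

theorem meetProperly_of_forall {A B P : Set Plane} (hP : P.Finite)
    (h : ∀ x y, (x, y) ∈ A → (x, y) ∈ B → (x, y) ∈ P)
    (hc : ∀ p ∈ P, CrossProperlyAt A B p) : MeetProperly A B :=
  ⟨hP.subset fun p hp => h p.1 p.2 hp.1 hp.2, fun p hp => hc p (h p.1 p.2 hp.1 hp.2)⟩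

theorem meetProperly_zero_one : MeetProperly (fiveArc 0) (fiveArc 1) := by
  refine meetProperly_of_forall (P := {(-4, 1), (4, 1)}) (by simp) ?_ ?_
  · intro x y
    simp only [mem_fiveArc_zero, mem_fiveArc_one, mem_insert_iff, mem_singleton_iff, Prod.mk.injEq]
    grind
  · rintro p (rfl | rfl) <;>
    -- All segments have integer coordinates and cross at interior integer points, so a square of
    -- half-side 1/2 sees only the two crossing segments.
    · refine crossProperlyAt_of_square one_half_pos fun x y _ _ _ _ => ?_
      rw [mem_fiveArc_zero, mem_fiveArc_one]
      grind

theorem meetProperly_one_two : MeetProperly (fiveArc 1) (fiveArc 2) := by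
  -- The arc that is horizontal at the crossings has to come first.
  refine MeetProperly.symm (meetProperly_of_forall (P := {(-4, 4), (4, 4)}) (by simp) ?_ ?_)
  · intro x y
    simp only [mem_fiveArc_one, mem_fiveArc_two, mem_insert_iff, mem_singleton_iff, Prod.mk.injEq]
    grind
  · rintro p (rfl | rfl) <;>
    · refine crossProperlyAt_of_square one_half_pos fun x y _ _ _ _ => ?_
      rw [mem_fiveArc_one, mem_fiveArc_two]
      grind

theorem meetProperly_two_three : MeetProperly (fiveArc 2) (fiveArc 3) := by
  refine meetProperly_of_forall (P := {(-6, 4), (-3, 4), (6, 4)}) (by simp) ?_ ?_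
  · intro x y
    simp only [mem_fiveArc_two, mem_fiveArc_three, mem_insert_iff, mem_singleton_iff,
      Prod.mk.injEq]
    grind
  · rintro p (rfl | rfl | rfl) <;>
    · refine crossProperlyAt_of_square one_half_pos fun x y _ _ _ _ => ?_
      rw [mem_fiveArc_two, mem_fiveArc_three]
      grind

theorem meetProperly_three_four : MeetProperly (fiveArc 3) (fiveArc 4) := by
  refine meetProperly_of_forall (P := {(-2, 2), (2, 2)}) (by simp) ?_ ?_
  · intro x y
    simp only [mem_fiveArc_three, mem_fiveArc_four, mem_insert_iff, mem_singleton_iff,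
      Prod.mk.injEq]
    grind
  · rintro p (rfl | rfl) <;>
    · refine crossProperlyAt_of_square one_half_pos fun x y _ _ _ _ => ?_
      rw [mem_fiveArc_three, mem_fiveArc_four]
      grind

theorem meetProperly_four_zero : MeetProperly (fiveArc 4) (fiveArc 0) := by
  refine MeetProperly.symm (meetProperly_of_forall (P := {(-2, 1), (2, 1)}) (by simp) ?_ ?_)
  · intro x y
    simp only [mem_fiveArc_zero, mem_fiveArc_four, mem_insert_iff, mem_singleton_iff,
      Prod.mk.injEq]
    grind
  · rintro p (rfl | rfl) <;>
    · refine crossProperlyAt_of_square one_half_pos fun x y _ _ _ _ => ?_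
      rw [mem_fiveArc_zero, mem_fiveArc_four]
      grind

theorem meetProperly_succ (k : Fin 5) : MeetProperly (fiveArc k) (fiveArc (k + 1)) := by
  fin_cases k
  exacts [meetProperly_zero_one, meetProperly_one_two, meetProperly_two_three,
    meetProperly_three_four, meetProperly_four_zero]

theorem disjoint_fiveArc_add_two (k : Fin 5) : Disjoint (fiveArc k) (fiveArc (k + 2)) := by
  rw [Set.disjoint_left]
  rintro ⟨x, y⟩
  fin_cases k
  · change _ ∈ fiveArc 0 → _ ∉ fiveArc 2
    rw [mem_fiveArc_zero, mem_fiveArc_two]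
    grind
  · change _ ∈ fiveArc 1 → _ ∉ fiveArc 3
    rw [mem_fiveArc_one, mem_fiveArc_three]
    grind
  · change _ ∈ fiveArc 2 → _ ∉ fiveArc 4
    rw [mem_fiveArc_two, mem_fiveArc_four]
    grind
  · change _ ∈ fiveArc 3 → _ ∉ fiveArc 0
    rw [mem_fiveArc_three, mem_fiveArc_zero]
    grind
  · change _ ∈ fiveArc 4 → _ ∉ fiveArc 1
    rw [mem_fiveArc_four, mem_fiveArc_one]
    grind

theorem succ_or_succ_of_fiveArc_inter {j k : Fin 5} (hjk : j ≠ k)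
    (h : (fiveArc j ∩ fiveArc k).Nonempty) : k = j + 1 ∨ j = k + 1 := by
  -- Distinct residues modulo 5 differ by ±1 or ±2, and arcs at distance 2 are disjoint.
  have key : ∀ j k : Fin 5, j ≠ k → k = j + 1 ∨ j = k + 1 ∨ k = j + 2 ∨ j = k + 2 := by decide
  rcases key j k hjk with h' | h' | rfl | rfl
  · exact Or.inl h'
  · exact Or.inr h'
  · exact absurd h (not_nonempty_iff_eq_empty.2 (disjoint_fiveArc_add_two j).inter_eq)
  · exact absurd h (not_nonempty_iff_eq_empty.2 (disjoint_fiveArc_add_two k).symm.inter_eq)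

theorem meetProperly_fiveArc {j k : Fin 5} (hjk : j ≠ k) :
    MeetProperly (fiveArc j) (fiveArc k) := by
  by_cases h : (fiveArc j ∩ fiveArc k).Nonempty
  · rcases succ_or_succ_of_fiveArc_inter hjk h with rfl | rfl
    · exact meetProperly_succ j
    · exact (meetProperly_succ k).symm
  · rw [not_nonempty_iff_eq_empty] at h
    simp [MeetProperly, h]

theorem fiveArc_inter_succ_nonempty (k : Fin 5) : (fiveArc k ∩ fiveArc (k + 1)).Nonempty := by
  fin_cases k
  · exact ⟨(4, 1), mem_fiveArc_zero.2 (by norm_num), mem_fiveArc_one.2 (by norm_num)⟩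
  · exact ⟨(4, 4), mem_fiveArc_one.2 (by norm_num), mem_fiveArc_two.2 (by norm_num)⟩
  · exact ⟨(6, 4), mem_fiveArc_two.2 (by norm_num), mem_fiveArc_three.2 (by norm_num)⟩
  · exact ⟨(2, 2), mem_fiveArc_three.2 (by norm_num), mem_fiveArc_four.2 (by norm_num)⟩
  · exact ⟨(2, 1), mem_fiveArc_four.2 (by norm_num), mem_fiveArc_zero.2 (by norm_num)⟩

theorem inter_fiveArc_nonempty_or {S : Set Plane} (hS : IsPreconnected S)
    (h0 : ((0, 0) : Plane) ∈ S) (h1 : ((0, 10) : Plane) ∈ S) (k : Fin 5) :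
    (S ∩ fiveArc k).Nonempty ∨ (S ∩ fiveArc (k + 1)).Nonempty := by
  suffices h : ∃ z ∈ S, z ∈ fiveArc k ∨ z ∈ fiveArc (k + 1) by
    obtain ⟨z, hz, h | h⟩ := h
    exacts [Or.inl ⟨z, hz, h⟩, Or.inr ⟨z, hz, h⟩]
  have key : ∀ {a b c d : ℝ}, a ≤ 0 → 0 ≤ b → c ≤ 0 → 0 ≤ d → d ≤ 10 →
      ∃ x y, (x, y) ∈ S ∧ (x = a ∧ c ≤ y ∧ y ≤ d ∨ x = b ∧ c ≤ y ∧ y ≤ d ∨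
        a ≤ x ∧ x ≤ b ∧ y = c ∨ a ≤ x ∧ x ≤ b ∧ y = d) := by
    intro a b c d ha hb hc hd hd'
    obtain ⟨⟨x, y⟩, hz, h⟩ := exists_mem_boundary_of_isPreconnected hS (a := a) (b := b) (c := c)
      (d := d) h0 h1 ⟨⟨ha, hb⟩, hc, hd⟩ (fun h => absurd h.2.2 (not_lt.2 hd'))
    refine ⟨x, y, hz, ?_⟩
    simp only [mem_union, mem_Icc, Prod.mk_le_mk] at h
    grind
  -- In each pair one arc supplies the left, bottom and right sides and the other the top. These
  -- roles cannot alternate around an odd cycle: arc 3 gives three sides with arc 2 but the top with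
  -- arc 4.
  fin_cases k
  · obtain ⟨x, y, hz, h⟩ := key (a := -4) (b := 4) (c := -2) (d := 1) (by norm_num) (by norm_num)
      (by norm_num) (by norm_num) (by norm_num)
    exact ⟨(x, y), hz, (or_congr mem_fiveArc_zero mem_fiveArc_one).2 (by grind)⟩
  · obtain ⟨x, y, hz, h⟩ := key (a := -4) (b := 4) (c := -2) (d := 4) (by norm_num) (by norm_num)
      (by norm_num) (by norm_num) (by norm_num)
    exact ⟨(x, y), hz, (or_congr mem_fiveArc_one mem_fiveArc_two).2 (by grind)⟩
  · obtain ⟨x, y, hz, h⟩ := key (a := -6) (b := 6) (c := -3) (d := 4) (by norm_num) (by norm_num)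
      (by norm_num) (by norm_num) (by norm_num)
    exact ⟨(x, y), hz, (or_congr mem_fiveArc_two mem_fiveArc_three).2 (by grind)⟩
  · obtain ⟨x, y, hz, h⟩ := key (a := -2) (b := 2) (c := -1) (d := 2) (by norm_num) (by norm_num)
      (by norm_num) (by norm_num) (by norm_num)
    exact ⟨(x, y), hz, (or_congr mem_fiveArc_three mem_fiveArc_four).2 (by grind)⟩
  · obtain ⟨x, y, hz, h⟩ := key (a := -2) (b := 2) (c := -1) (d := 1) (by norm_num) (by norm_num)
      (by norm_num) (by norm_num) (by norm_num)
    exact ⟨(x, y), hz, (or_congr mem_fiveArc_four mem_fiveArc_zero).2 (by grind)⟩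

/-- Otherwise `P` would alternate around a cycle of odd length. -/
theorem exists_and_succ_of_forall_or_succ {P : Fin 5 → Prop} (h : ∀ k, P k ∨ P (k + 1)) :
    ∃ k, P k ∧ P (k + 1) := by
  by_contra! hc
  have hP (k : Fin 5) : P (k + 1) ↔ ¬ P k := by
    have := h k
    have := hc k
    tauto
  have h5 : P (0 + 1 + 1 + 1 + 1 + 1) ↔ ¬ P 0 := by
    simp only [hP, not_not]
  -- Five successors return to 0 in `Fin 5`.
  change P 0 ↔ ¬ P 0 at h5
  tauto

theorem exists_succ_inter_fiveArc_nonempty {S : Set Plane} (hS : IsPreconnected S)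
    (h0 : ((0, 0) : Plane) ∈ S) (h1 : ((0, 10) : Plane) ∈ S) :
    ∃ k, (S ∩ fiveArc k).Nonempty ∧ (S ∩ fiveArc (k + 1)).Nonempty :=
  exists_and_succ_of_forall_or_succ (P := fun k => (S ∩ fiveArc k).Nonempty)
    (inter_fiveArc_nonempty_or hS h0 h1)

/-! ### The two matchings and the drawing of the first -/

/-- The matching of the first `m` pairs of consecutive vertices. -/
def pairMatching (m : ℕ) : SimpleGraph (Fin 12) where
  Adj u v := u ≠ v ∧ u.val / 2 = v.val / 2 ∧ u.val / 2 < m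
  symm := ⟨fun _ _ h => ⟨h.1.symm, h.2.1.symm, h.2.1 ▸ h.2.2⟩⟩
  loopless := ⟨fun _ h => h.1 rfl⟩

theorem isMatching_pairMatching (m : ℕ) : IsMatching (pairMatching m) := by
  rintro u v w ⟨h1, h2, -⟩ ⟨h3, h4, -⟩
  have := Fin.val_ne_of_ne h1
  have := Fin.val_ne_of_ne h3
  apply Fin.ext
  omega

theorem pairEdge_mem_edgeSet {m : ℕ} {k : Fin 6} (h : k.val < m) :
    pairEdge k ∈ (pairMatching m).edgeSet := by
  refine (SimpleGraph.mem_edgeSet _).2 ⟨?_, ?_, ?_⟩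
  · simp
  · simp only
    omega
  · simp only
    omega

theorem pairEdge_injective : Function.Injective pairEdge := by
  decide

theorem exists_pairEdge_eq {u v : Fin 12} (h : (pairMatching 5).Adj u v) :
    ∃ k : Fin 5, (u = ⟨2 * k, by omega⟩ ∧ v = ⟨2 * k + 1, by omega⟩) ∨
      (v = ⟨2 * k, by omega⟩ ∧ u = ⟨2 * k + 1, by omega⟩) := by
  obtain ⟨h1, h2, h3⟩ := h
  have := Fin.val_ne_of_ne h1
  refine ⟨⟨u / 2, h3⟩, ?_⟩
  simp only [Fin.ext_iff]
  omega

theorem exists_eq_pairEdge (e : (pairMatching 5).edgeSet) :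
    ∃ k : Fin 5, (e : Sym2 (Fin 12)) = pairEdge k.castSucc := by
  obtain ⟨e, he⟩ := e
  induction e with | _ u v =>
  obtain ⟨k, ⟨rfl, rfl⟩ | ⟨rfl, rfl⟩⟩ := exists_pairEdge_eq ((SimpleGraph.mem_edgeSet _).1 he)
  · exact ⟨k, rfl⟩
  · exact ⟨k, Sym2.eq_swap⟩

/-- The arc that represents an edge. -/
def arcOfEdge (e : Sym2 (Fin 12)) : Set Plane :=
  {p | ∃ k : Fin 5, e = pairEdge k.castSucc ∧ p ∈ fiveArc k}

theorem arcOfEdge_pairEdge (k : Fin 5) : arcOfEdge (pairEdge k.castSucc) = fiveArc k := by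
  ext p
  constructor
  · rintro ⟨j, hj, hp⟩
    rwa [Fin.castSucc_injective _ (pairEdge_injective hj)]
  · exact fun hp => ⟨k, rfl, hp⟩

/-- The drawing of the matching of the first five pairs by the five arcs. -/
def fiveArcDrawing : Drawing (pairMatching 5) where
  pos := vertexPos
  pos_injective := vertexPos_injective
  arc e := arcOfEdge e
  isArc _ _ h := by
    change IsJordanArc (arcOfEdge s(_, _)) _ _
    obtain ⟨k, ⟨rfl, rfl⟩ | ⟨rfl, rfl⟩⟩ := exists_pairEdge_eq h
    · exact (arcOfEdge_pairEdge k).symm ▸ isJordanArc_fiveArc k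
    · rw [Sym2.eq_swap]
      exact (arcOfEdge_pairEdge k).symm ▸ (isJordanArc_fiveArc k).symm
  mem_of_pos_mem_arc e v h := by
    obtain ⟨k, hk⟩ := exists_eq_pairEdge e
    rw [hk, arcOfEdge_pairEdge] at h
    exact hk ▸ mem_pairEdge_of_vertexPos_mem k v h

theorem fiveArcDrawing_arc {e : (pairMatching 5).edgeSet} {k : Fin 5}
    (h : (e : Sym2 (Fin 12)) = pairEdge k.castSucc) : fiveArcDrawing.arc e = fiveArc k := by
  change arcOfEdge e = _
  rw [h, arcOfEdge_pairEdge]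

theorem isInGeneralPosition_fiveArcDrawing : fiveArcDrawing.IsInGeneralPosition := by
  intro e f hef
  obtain ⟨j, hj⟩ := exists_eq_pairEdge e
  obtain ⟨k, hk⟩ := exists_eq_pairEdge f
  rw [fiveArcDrawing_arc hj, fiveArcDrawing_arc hk]
  have hjk : j ≠ k := fun h => hef (Subtype.ext (by rw [hj, hk, h]))
  exact ⟨(meetProperly_fiveArc hjk).1, fun p hp _ => (meetProperly_fiveArc hjk).2 p hp⟩

theorem isQuasiplanar_fiveArcDrawing : fiveArcDrawing.IsQuasiplanar := by
  rintro ⟨e, f, g, hef, hfg, heg⟩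
  obtain ⟨i, hi⟩ := exists_eq_pairEdge e
  obtain ⟨j, hj⟩ := exists_eq_pairEdge f
  obtain ⟨k, hk⟩ := exists_eq_pairEdge g
  have key : ∀ {e f : (pairMatching 5).edgeSet} {j k : Fin 5},
      (e : Sym2 (Fin 12)) = pairEdge j.castSucc → (f : Sym2 (Fin 12)) = pairEdge k.castSucc →
      fiveArcDrawing.Crosses e f → k = j + 1 ∨ j = k + 1 := by
    rintro e f j k hj hk ⟨hne, p, hpe, hpf, -⟩
    rw [fiveArcDrawing_arc hj] at hpe
    rw [fiveArcDrawing_arc hk] at hpf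
    exact succ_or_succ_of_fiveArc_inter (fun h => hne (Subtype.ext (by rw [hj, hk, h])))
      ⟨p, hpe, hpf⟩
  -- The five-cycle contains no triangle.
  have triangleFree : ∀ i j k : Fin 5, (j = i + 1 ∨ i = j + 1) → (k = j + 1 ∨ j = k + 1) →
      ¬ (k = i + 1 ∨ i = k + 1) := by decide
  exact triangleFree i j k (key hi hj hef) (key hj hk hfg) (key hi hk heg)

/-- In a drawing of a matching, distinct edges with a common point cross. -/
theorem Drawing.crosses_of_isMatching {V : Type*} {G : SimpleGraph V} (hG : IsMatching G)
    (Γ : Drawing G) {e f : G.edgeSet} (hef : e ≠ f) (h : (Γ.arc e ∩ Γ.arc f).Nonempty) :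
    Γ.Crosses e f := by
  obtain ⟨p, hpe, hpf⟩ := h
  refine ⟨hef, p, hpe, hpf, ?_⟩
  rintro ⟨v, rfl⟩
  obtain ⟨u, hu⟩ := Γ.mem_of_pos_mem_arc e v hpe
  obtain ⟨w, hw⟩ := Γ.mem_of_pos_mem_arc f v hpf
  have he := e.2
  have hf := f.2
  rw [hu, SimpleGraph.mem_edgeSet] at he
  rw [hw, SimpleGraph.mem_edgeSet] at hf
  exact hef (Subtype.ext (by rw [hu, hw, hG v u w he hf]))

/-- The sixth pair is the edge from (0, 0) to (0, 10). Of its arc only connectedness and the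
endpoints matter, so the obstruction holds with or without general position of `Γ`. -/
theorem not_isQuaSEFE_fiveArcDrawing (Γ : Drawing (pairMatching 6)) :
    ¬ IsQuaSEFE fiveArcDrawing Γ := by
  rintro ⟨-, hquasi, hpos, harc⟩
  have hadj : (pairMatching 6).Adj 10 11 := ⟨by decide, by decide, by decide⟩
  obtain ⟨γ, -, hγ⟩ := Γ.isArc 10 11 hadj
  have hp0 : Γ.pos 10 = (0, 0) := (hpos 10).symm
  have hp1 : Γ.pos 11 = (0, 10) := (hpos 11).symm
  let e : (pairMatching 6).edgeSet := ⟨pairEdge 5, pairEdge_mem_edgeSet (by decide)⟩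
  let f (k : Fin 5) : (pairMatching 6).edgeSet :=
    ⟨pairEdge k.castSucc, pairEdge_mem_edgeSet (by simp; omega)⟩
  have hf (k : Fin 5) : Γ.arc (f k) = fiveArc k :=
    (harc _ (pairEdge_mem_edgeSet (by simp)) (f k).2).symm.trans (fiveArcDrawing_arc rfl)
  have he : range γ = Γ.arc e := hγ
  have hconn : IsPreconnected (Γ.arc e) := he ▸ isPreconnected_range γ.continuous
  have h0 : ((0, 0) : Plane) ∈ Γ.arc e := he ▸ ⟨0, γ.source.trans hp0⟩
  have h1 : ((0, 10) : Plane) ∈ Γ.arc e := he ▸ ⟨1, γ.target.trans hp1⟩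
  obtain ⟨k, hk, hk'⟩ := exists_succ_inter_fiveArc_nonempty hconn h0 h1
  have hne (k : Fin 5) : e ≠ f k := fun h =>
    (Fin.castSucc_lt_last k).ne' (pairEdge_injective (congrArg Subtype.val h))
  have hne' : f k ≠ f (k + 1) := fun h => by
    have := Fin.castSucc_injective _ (pairEdge_injective (congrArg Subtype.val h))
    simp at this
  have hM := isMatching_pairMatching 6
  refine hquasi ⟨e, f k, f (k + 1), Γ.crosses_of_isMatching hM (hne k) ?_,
    Γ.crosses_of_isMatching hM hne' ?_, Γ.crosses_of_isMatching hM (hne _) ?_⟩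
  · rwa [hf]
  · rw [hf, hf]
    exact fiveArc_inter_succ_nonempty k
  · rwa [hf]

end QuaSEFE

theorem theorem7 :
    ∃ (n : ℕ) (M₁ M₂ : SimpleGraph (Fin n)),
      QuaSEFE.IsMatching M₁ ∧ QuaSEFE.IsMatching M₂ ∧
      ∃ Γ₁ : QuaSEFE.Drawing M₁, Γ₁.IsInGeneralPosition ∧ Γ₁.IsQuasiplanar ∧
        ¬ ∃ Γ₂ : QuaSEFE.Drawing M₂, QuaSEFE.IsQuaSEFE Γ₁ Γ₂ :=
  ⟨12, QuaSEFE.pairMatching 5, QuaSEFE.pairMatching 6, QuaSEFE.isMatching_pairMatching 5,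
    QuaSEFE.isMatching_pairMatching 6, QuaSEFE.fiveArcDrawing,
    QuaSEFE.isInGeneralPosition_fiveArcDrawing, QuaSEFE.isQuasiplanar_fiveArcDrawing,
    fun ⟨Γ₂, h⟩ => QuaSEFE.not_isQuaSEFE_fiveArcDrawing Γ₂ h⟩
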